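/- Let $\alpha>0$ and let $\omega_\alpha(y)=(1-y^2)^\alpha$ on $I=[-1,1]$. For $c>0$ let $\mathcal F_c^{(\alpha)}$ be the bounded operator on the complex space $L^2(I,\omega_\alpha)$ given by $\mathcal F_c^{(\alpha)}f(x)=\int_{-1}^1 e^{icxy}f(y)\,\omega_\alpha(y)\,dy$, and let $Q_c^{(\alpha)}=\frac{c}{2\pi}\,\mathcal F_c^{(\alpha)*}\mathcal F_c^{(\alpha)}$. Let $0<\delta<1$ and let $M_c(\delta)$ be the number of eigenvalues of $Q_c^{(\alpha)}$, counted with multiplicity, that are not smaller than $\delta$. Let $B$ be the beta function and $$\gamma_\alpha=2^{4\alpha}\left(\frac{B(2\alpha+1,2\alpha+1)}{B(\alpha+1,\alpha+1)}\right)^2 .$$ Then, for every $c>0$, $M_c(\delta)$ is finite and $$\frac{\gamma_\alpha-\delta}{1-\delta}\,\frac{c}{2\pi}\left(2^{2\alpha+1}B(\alpha+1,\alpha+1)\right)^2+o(c)\;\le\; M_c(\delta)\;\le\;\frac1\delta\,\frac{c}{2\pi}\left(2^{2\alpha+1}B(\alpha+1,\alpha+1)\right)^2 ,$$ where $o(c)$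 is a function $r(c)$ (for the given $\alpha$ and $\delta$) with $r(c)/c\to0$ as $c\to\infty$. -/

import Mathlib

open MeasureTheory Filter Asymptotics
open scoped ENNReal

noncomputable section

/-- The measure `ω_α(y) dy` on `[-1, 1]`, with the weight `ω_α(y) = (1 - y^2)^α`. -/
def gegenbauerMeasure (α : ℝ) : Measure ℝ :=
  (volume.restrict (Set.Icc (-1 : ℝ) 1)).withDensity
    (fun y => ENNReal.ofReal ((1 - y ^ 2) ^ α))

theorem isFiniteMeasure_gegenbauerMeasure {α : ℝ} (hα : 0 < α) :
    IsFiniteMeasure (gegenbauerMeasure α) := by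
  refine isFiniteMeasure_withDensity ?_
  have h : ∫⁻ y in Set.Icc (-1 : ℝ) 1, ENNReal.ofReal ((1 - y ^ 2) ^ α)
      ≤ ∫⁻ _ in Set.Icc (-1 : ℝ) 1, 1 := by
    refine setLIntegral_mono measurable_const fun y hy => ?_
    rw [ENNReal.ofReal_le_one]
    refine Real.rpow_le_one ?_ ?_ hα.le
    · nlinarith [hy.1, hy.2]
    · nlinarith [sq_nonneg y]
  refine (h.trans_lt ?_).ne
  simp

/-- The function `x ↦ ∫ e^{icxy} f(y) dμ(y)`. -/
def fourierIntegralFun (μ : Measure ℝ) (c : ℝ) (f : ℝ → ℂ) (x : ℝ) : ℂ :=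
  ∫ y, Complex.exp (Complex.I * c * x * y) * f y ∂μ

theorem norm_fourierKernel (c x y : ℝ) : ‖Complex.exp (Complex.I * c * x * y)‖ = 1 := by
  rw [show Complex.I * c * x * y = ((c * x * y : ℝ) : ℂ) * Complex.I by push_cast; ring]
  exact Complex.norm_exp_ofReal_mul_I _

theorem integrable_fourierKernel_mul (μ : Measure ℝ) (c x : ℝ) {f : ℝ → ℂ}
    (hf : Integrable f μ) :
    Integrable (fun y : ℝ => Complex.exp (Complex.I * c * x * y) * f y) μ := by
  refine hf.bdd_mul (c := 1) ?_ (Eventually.of_forall fun y => (norm_fourierKernel c x y).le)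
  exact Continuous.aestronglyMeasurable (by fun_prop)

theorem norm_fourierIntegralFun_le (μ : Measure ℝ) (c : ℝ) (f : ℝ → ℂ) (x : ℝ) :
    ‖fourierIntegralFun μ c f x‖ ≤ ∫ y, ‖f y‖ ∂μ := by
  refine (norm_integral_le_integral_norm _).trans_eq ?_
  simp only [norm_mul, norm_fourierKernel, one_mul]

theorem continuous_fourierIntegralFun (μ : Measure ℝ) (c : ℝ) {f : ℝ → ℂ}
    (hf : Integrable f μ) : Continuous (fourierIntegralFun μ c f) := by
  refine continuous_of_dominated (bound := fun y => ‖f y‖) ?_ ?_ hf.norm ?_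
  · exact fun x => (integrable_fourierKernel_mul μ c x hf).aestronglyMeasurable
  · exact fun x => Eventually.of_forall fun y => by
      simp only [norm_mul, norm_fourierKernel, one_mul, le_refl]
  · exact Eventually.of_forall fun y => by fun_prop

theorem memLp_fourierIntegralFun (μ : Measure ℝ) [IsFiniteMeasure μ] (c : ℝ) {f : ℝ → ℂ}
    (hf : Integrable f μ) : MemLp (fourierIntegralFun μ c f) 2 μ :=
  MemLp.of_bound (continuous_fourierIntegralFun μ c hf).aestronglyMeasurable _
    (Eventually.of_forall (norm_fourierIntegralFun_le μ c f))

theorem integrable_of_lpTwo (μ : Measure ℝ) [IsFiniteMeasure μ] (f : Lp ℂ 2 μ) :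
    Integrable f μ :=
  (Lp.memLp f).integrable one_le_two

theorem integral_norm_le_lpTwo (μ : Measure ℝ) [IsFiniteMeasure μ] (f : Lp ℂ 2 μ) :
    ∫ y, ‖f y‖ ∂μ ≤ ((μ Set.univ) ^ (1 / 2 : ℝ)).toReal * ‖f‖ := by
  have h := eLpNorm_le_eLpNorm_mul_rpow_measure_univ (p := 1) (q := 2) one_le_two
    (Lp.aestronglyMeasurable f)
  rw [integral_norm_eq_lintegral_enorm (Lp.aestronglyMeasurable f), ← eLpNorm_one_eq_lintegral_enorm,
    Lp.norm_def, ← ENNReal.toReal_mul]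
  refine ENNReal.toReal_mono ?_ (h.trans_eq ?_)
  · exact ENNReal.mul_ne_top (ENNReal.rpow_ne_top_of_nonneg (by norm_num) (measure_ne_top _ _))
      (Lp.eLpNorm_ne_top f)
  · rw [mul_comm]
    norm_num

/-- The weighted finite Fourier transform `f ↦ (x ↦ ∫ e^{icxy} f(y) dμ(y))`, as a bounded
operator on `L²(μ)`, for a finite measure `μ` on the real line. -/
def finiteFourierTransform (μ : Measure ℝ) [IsFiniteMeasure μ] (c : ℝ) :
    Lp ℂ 2 μ →L[ℂ] Lp ℂ 2 μ :=
  LinearMap.mkContinuous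
    { toFun := fun f => (memLp_fourierIntegralFun μ c (integrable_of_lpTwo μ f)).toLp
        (fourierIntegralFun μ c f)
      map_add' := fun f g => by
        rw [← MemLp.toLp_add]
        refine MemLp.toLp_congr _ _ (Eventually.of_forall fun x => ?_)
        simp only [Pi.add_apply, fourierIntegralFun]
        rw [← integral_add (integrable_fourierKernel_mul μ c x (integrable_of_lpTwo μ f))
          (integrable_fourierKernel_mul μ c x (integrable_of_lpTwo μ g))]
        refine integral_congr_ae ?_
        filter_upwards [Lp.coeFn_add f g] with y hy
        rw [hy, Pi.add_apply, mul_add]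
      map_smul' := fun a f => by
        rw [RingHom.id_apply, ← MemLp.toLp_const_smul]
        refine MemLp.toLp_congr _ _ (Eventually.of_forall fun x => ?_)
        simp only [Pi.smul_apply, smul_eq_mul, fourierIntegralFun]
        rw [← integral_const_mul]
        refine integral_congr_ae ?_
        filter_upwards [Lp.coeFn_smul a f] with y hy
        rw [hy, Pi.smul_apply, smul_eq_mul]
        ring }
    ((measureUnivNNReal μ : ℝ) ^ ((2 : ℝ≥0∞).toReal⁻¹) * ((μ Set.univ) ^ (1 / 2 : ℝ)).toReal)
    (fun f => by
      refine (Lp.norm_le_of_ae_bound (C := ∫ y, ‖f y‖ ∂μ)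
        (integral_nonneg fun y => norm_nonneg _) ?_).trans ?_
      · filter_upwards [MemLp.coeFn_toLp
          (memLp_fourierIntegralFun μ c (integrable_of_lpTwo μ f))] with x hx
        exact (congrArg norm hx).trans_le (norm_fourierIntegralFun_le μ c f x)
      · rw [mul_assoc]
        exact mul_le_mul_of_nonneg_left (integral_norm_le_lpTwo μ f) (by positivity))

/-- The operator `𝓕_c^{(α)} f(x) = ∫_{-1}^1 e^{icxy} f(y) ω_α(y) dy` on `L²([-1, 1], ω_α)`. -/
def weightedFourier {α : ℝ} (hα : 0 < α) (c : ℝ) :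
    Lp ℂ 2 (gegenbauerMeasure α) →L[ℂ] Lp ℂ 2 (gegenbauerMeasure α) :=
  haveI := isFiniteMeasure_gegenbauerMeasure hα
  finiteFourierTransform (gegenbauerMeasure α) c

/-- The operator `Q_c^{(α)} = (c / 2π) 𝓕_c^{(α)*} 𝓕_c^{(α)}` on `L²([-1, 1], ω_α)`. -/
def weightedSinc {α : ℝ} (hα : 0 < α) (c : ℝ) :
    Lp ℂ 2 (gegenbauerMeasure α) →L[ℂ] Lp ℂ 2 (gegenbauerMeasure α) :=
  ((c / (2 * Real.pi) : ℝ) : ℂ) •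
    (ContinuousLinearMap.adjoint (weightedFourier hα c) ∘L weightedFourier hα c)

/-- The set of the real eigenvalues of `T` that are not smaller than `δ`. -/
def eigenvaluesGE {E : Type*} [NormedAddCommGroup E] [NormedSpace ℂ E] (T : E →L[ℂ] E) (δ : ℝ) :
    Set ℝ :=
  {μ : ℝ | δ ≤ μ ∧ Module.End.HasEigenvalue (T : Module.End ℂ E) (μ : ℂ)}

/-- The number of real eigenvalues of `T` that are not smaller than `δ`, each counted with its
multiplicity (the dimension of its eigenspace); this is meaningful when the set of these
eigenvalues is finite and their eigenspaces are finite-dimensional. -/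
def eigenvalueCount {E : Type*} [NormedAddCommGroup E] [NormedSpace ℂ E] (T : E →L[ℂ] E) (δ : ℝ) :
    ℕ :=
  ∑ᶠ μ ∈ eigenvaluesGE T δ,
    Module.finrank ℂ (Module.End.eigenspace (T : Module.End ℂ E) (μ : ℂ))

/-- The constant `γ_α = 2^{4α} (B(2α+1, 2α+1) / B(α+1, α+1))²`. -/
def gammaConst (α : ℝ) : ℝ :=
  2 ^ (4 * α) *
    (ProbabilityTheory.beta (2 * α + 1) (2 * α + 1) / ProbabilityTheory.beta (α + 1) (α + 1)) ^ 2

/-- The quantity `(c / 2π) (2^{2α+1} B(α+1, α+1))²`. -/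
def mainTerm (α c : ℝ) : ℝ :=
  c / (2 * Real.pi) * (2 ^ (2 * α + 1) * ProbabilityTheory.beta (α + 1) (α + 1)) ^ 2

end

/-! Write λ_i for the eigenvalues of Q_c in an eigenbasis. Three facts suffice: 0 ≤ λ_i ≤ 1, the
value τ of Σ λ_i, and the size of κ = Σ λ_i². Comparing δ·1_{λ ≥ δ} ≤ λ gives the upper bound. The
lower bound comes from λ² − δλ ≤ (1 − δ)·1_{λ ≥ δ}, which sums to κ − δτ ≤ (1 − δ) M_c(δ).

The bound λ_i ≤ 1 is Plancherel together with ω ≤ 1 (`mul_norm_sq_weightedFourier_le`). Parseval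
applied to plane waves gives the trace (`tsum_enorm_sq_finiteFourierTransform`) and the
Hilbert–Schmidt norm of Q_c (`tsum_eigenvalues_sq`). The trace is exactly the main term. In the
second moment, rescaling by 2π/c makes ω(x − 2πξ/c) tend to ω(x), and the integral tends to ∫ω² ·
∫|ω̂|² = (∫ω²)² (`tendsto_rescaledEnergy`); this limit produces γ_α. -/

/-! ### Plancherel for the Fourier integral on L¹ ∩ L². -/

section Plancherel

open scoped FourierTransform SchwartzMap ContDiff

/-- Tested against a smooth compactly supported g, both sides equal ∫ 𝓕g · f: the left by duality of
tempered distributions, the right by Fubini. -/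
theorem coeFn_fourier_toLp_ae_eq {f : ℝ → ℂ} (hf₁ : Integrable f) (hf₂ : MemLp f 2) :
    (𝓕 (hf₂.toLp f) : Lp ℂ 2 (volume : Measure ℝ)) =ᵐ[volume] 𝓕 f := by
  have hcont : Continuous (𝓕 f) :=
    VectorFourier.fourierIntegral_continuous Real.continuous_fourierChar
      (by exact continuous_inner) hf₁
  refine ae_eq_of_integral_contDiff_smul_eq
    ((Lp.memLp _).locallyIntegrable one_le_two) hcont.locallyIntegrable ?_
  intro g hg hgc
  have hg₁ : HasCompactSupport (Complex.ofRealCLM ∘ g) := hgc.comp_left rfl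
  have hg₂ : ContDiff ℝ ∞ (Complex.ofRealCLM ∘ g) := Complex.ofRealCLM.contDiff.comp hg
  set G : 𝓢(ℝ, ℂ) := hg₁.toSchwartzMap hg₂ with hG
  have hGg : ∀ x, G x = (g x : ℂ) := fun x => rfl
  have h := congrArg (fun u : 𝓢'(ℝ, ℂ) => u G)
    (Lp.fourier_toTemperedDistribution_eq (hf₂.toLp f))
  simp only [TemperedDistribution.fourier_apply, Lp.toTemperedDistribution_apply] at h
  calc ∫ x, g x • (𝓕 (hf₂.toLp f) : Lp ℂ 2 (volume : Measure ℝ)) x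
      = ∫ x, G x • (𝓕 (hf₂.toLp f) : Lp ℂ 2 (volume : Measure ℝ)) x := by
        simp only [hGg, Complex.real_smul, smul_eq_mul]
    _ = ∫ x, 𝓕 G x • (hf₂.toLp f) x := h.symm
    _ = ∫ x, 𝓕 (G : ℝ → ℂ) x • f x := by
        refine integral_congr_ae ?_
        filter_upwards [hf₂.coeFn_toLp] with x hx
        rw [hx, SchwartzMap.fourier_coe]
    _ = ∫ x, G x • 𝓕 f x := by
        have h := VectorFourier.integral_fourierIntegral_smul_eq_flip (L := innerₗ ℝ) (μ := volume)
          (ν := volume) (f := (G : ℝ → ℂ)) (g := f)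
          Real.continuous_fourierChar (by exact continuous_inner) G.integrable hf₁
        rwa [flip_innerₗ] at h
    _ = ∫ x, g x • 𝓕 f x := by simp only [hGg, Complex.real_smul, smul_eq_mul]

theorem enorm_sq_eq_lintegral {X : Type*} [MeasurableSpace X] {μ : Measure X} (f : Lp ℂ 2 μ) :
    ‖f‖ₑ ^ 2 = ∫⁻ x, ‖f x‖ₑ ^ 2 ∂μ := by
  rw [Lp.enorm_def, eLpNorm_eq_lintegral_rpow_enorm_toReal two_ne_zero ENNReal.ofNat_ne_top,
    ← ENNReal.rpow_natCast, ← ENNReal.rpow_mul]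
  norm_num

/-- **Plancherel's theorem** for the Fourier integral on `L¹ ∩ L²`. -/
theorem lintegral_enorm_sq_fourier {f : ℝ → ℂ} (hf₁ : Integrable f) (hf₂ : MemLp f 2) :
    ∫⁻ ξ, ‖𝓕 f ξ‖ₑ ^ 2 = ∫⁻ x, ‖f x‖ₑ ^ 2 := by
  have h : ‖(𝓕 (hf₂.toLp f) : Lp ℂ 2 (volume : Measure ℝ))‖ₑ ^ 2 = ‖hf₂.toLp f‖ₑ ^ 2 := by
    rw [← ofReal_norm, ← ofReal_norm, Lp.norm_fourier_eq]
  rw [enorm_sq_eq_lintegral, enorm_sq_eq_lintegral] at h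
  exact (lintegral_congr_ae ((coeFn_fourier_toLp_ae_eq hf₁ hf₂).fun_comp
    (fun z => ‖z‖ₑ ^ 2))).symm.trans <| h.trans <|
      lintegral_congr_ae (hf₂.coeFn_toLp.fun_comp (fun z => ‖z‖ₑ ^ 2))

end Plancherel

/-! ### Eigenbases of compact symmetric operators and counting eigenvalues. -/

section EigenvectorBasis

open Module.End

universe u

variable {E : Type u} [NormedAddCommGroup E] [InnerProductSpace ℂ E]

/-- Distinct members lie at distance √2, so balls of radius 1/2 are disjoint. Countability later
allows exchanging sums over a basis with integrals. -/
theorem Orthonormal.countable_of_separableSpace [TopologicalSpace.SeparableSpace E] {ι : Type*}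
    {v : ι → E} (hv : Orthonormal ℂ v) : Countable ι := by
  rw [← Set.countable_univ_iff]
  refine Set.PairwiseDisjoint.countable_of_isOpen (s := fun i => Metric.ball (v i) (1 / 2))
    (fun i _ j _ hij => Metric.ball_disjoint_ball ?_) (fun i _ => Metric.isOpen_ball)
    (fun i _ => ⟨v i, Metric.mem_ball_self (by norm_num)⟩)
  have h : dist (v i) (v j) ^ 2 = 2 := by
    rw [dist_eq_norm, @norm_sub_sq ℂ, hv.1 i, hv.1 j, hv.2 hij]
    norm_num
  nlinarith [dist_nonneg (x := v i) (y := v j)]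

namespace HilbertBasis

variable {ι : Type*} (b : HilbertBasis ι ℂ E) {T : E →L[ℂ] E} {l : ι → ℝ}

theorem hasSum_norm_inner_sq (x : E) : HasSum (fun i => ‖inner ℂ (b i) x‖ ^ 2) (‖x‖ ^ 2) := by
  have h := Complex.hasSum_re (b.hasSum_inner_mul_inner x x)
  simp only [← inner_conj_symm x (b _), RCLike.conj_mul] at h
  convert h using 1
  · funext i
    norm_cast
  · rw [inner_self_eq_norm_sq_to_K]
    norm_cast

theorem inner_eq_zero_of_mem_eigenspace (hT : T.IsSymmetric)
    (hb : ∀ i, T (b i) = (l i : ℂ) • b i) {μ : ℝ} {v : E}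
    (hv : v ∈ eigenspace (T : Module.End ℂ E) (μ : ℂ)) {i : ι} (hi : l i ≠ μ) :
    inner ℂ (b i) v = 0 := by
  have h := hT (b i) v
  have hv' : (T : E →ₗ[ℂ] E) v = (μ : ℂ) • v := mem_eigenspace_iff.mp hv
  rw [hv', inner_smul_right] at h
  simp only [ContinuousLinearMap.coe_coe, hb, inner_smul_left, Complex.conj_ofReal] at h
  have hne : ((l i : ℂ) - μ) ≠ 0 := by exact_mod_cast sub_ne_zero.mpr hi
  exact (mul_eq_zero.mp (show ((l i : ℂ) - μ) * inner ℂ (b i) v = 0 by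
    rw [sub_mul, h, sub_self])).resolve_left hne

theorem eigenspace_eq_span (hT : T.IsSymmetric) (hb : ∀ i, T (b i) = (l i : ℂ) • b i)
    {μ : ℝ} {s : Finset ι} (hs : ∀ i, i ∈ s ↔ l i = μ) :
    eigenspace (T : Module.End ℂ E) (μ : ℂ) =
      Submodule.span ℂ (Set.range fun i : s => b i) := by
  refine le_antisymm (fun v hv => ?_) (Submodule.span_le.mpr ?_)
  · have h : HasSum (fun i => b.repr v i • b i) (∑ i ∈ s, b.repr v i • b i) :=
      hasSum_sum_of_ne_finset_zero fun i hi => by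
        rw [b.repr_apply_apply, b.inner_eq_zero_of_mem_eigenspace hT hb hv (mt (hs i).mpr hi),
          zero_smul]
    rw [(b.hasSum_repr v).unique h]
    exact Submodule.sum_mem _ fun i hi =>
      Submodule.smul_mem _ _ (Submodule.subset_span ⟨⟨i, hi⟩, rfl⟩)
  · rintro _ ⟨i, rfl⟩
    refine mem_eigenspace_iff.mpr ?_
    rw [← (hs i).mp i.2]
    exact hb i

theorem finrank_eigenspace (hT : T.IsSymmetric) (hb : ∀ i, T (b i) = (l i : ℂ) • b i)
    {μ : ℝ} {s : Finset ι} (hs : ∀ i, i ∈ s ↔ l i = μ) :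
    Module.finrank ℂ (eigenspace (T : Module.End ℂ E) (μ : ℂ)) = s.card := by
  rw [b.eigenspace_eq_span hT hb hs, finrank_span_eq_card, Fintype.card_coe]
  exact b.orthonormal.linearIndependent.comp _ Subtype.val_injective

theorem eigenvaluesGE_eq_image (hT : T.IsSymmetric) (hb : ∀ i, T (b i) = (l i : ℂ) • b i)
    {δ : ℝ} {s : Finset ι} (hs : ∀ i, i ∈ s ↔ δ ≤ l i) :
    eigenvaluesGE T δ = s.image l := by
  ext μ
  simp only [eigenvaluesGE, Set.mem_ofPred_eq, Finset.coe_image, Set.mem_image, Finset.mem_coe]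
  constructor
  · rintro ⟨hδ, hμ⟩
    obtain ⟨v, hv, hv₀⟩ := hμ.exists_hasEigenvector
    by_contra! hne
    refine hv₀ (b.repr.map_eq_zero_iff.mp (lp.ext (funext fun i => ?_)))
    rw [b.repr_apply_apply, b.inner_eq_zero_of_mem_eigenspace hT hb hv]
    · rfl
    · rintro rfl
      exact hne i ((hs i).mpr hδ) rfl
  · rintro ⟨i, hi, rfl⟩
    exact ⟨(hs i).mp hi, hasEigenvalue_of_hasEigenvector
      ⟨mem_eigenspace_iff.mpr (hb i), b.orthonormal.ne_zero i⟩⟩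

theorem finiteDimensional_eigenspace (hT : T.IsSymmetric)
    (hb : ∀ i, T (b i) = (l i : ℂ) • b i) {δ : ℝ} {s : Finset ι} (hs : ∀ i, i ∈ s ↔ δ ≤ l i)
    {μ : ℝ} (hμ : δ ≤ μ) : FiniteDimensional ℂ (eigenspace (T : Module.End ℂ E) (μ : ℂ)) := by
  classical
  rw [b.eigenspace_eq_span hT hb (s := s.filter fun i => l i = μ) (fun i => by
    rw [Finset.mem_filter, hs]
    exact ⟨And.right, fun h => ⟨h ▸ hμ, h⟩⟩)]
  exact FiniteDimensional.span_of_finite ℂ (Set.finite_range _)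

/-- Each eigenspace is spanned by the basis vectors in the corresponding fibre of `l`, so grouping
indices by their value turns multiplicities into a count of indices. -/
theorem eigenvalueCount_eq_card (hT : T.IsSymmetric) (hb : ∀ i, T (b i) = (l i : ℂ) • b i)
    {δ : ℝ} {s : Finset ι} (hs : ∀ i, i ∈ s ↔ δ ≤ l i) : eigenvalueCount T δ = s.card := by
  classical
  rw [eigenvalueCount, b.eigenvaluesGE_eq_image hT hb hs]
  rw [finsum_mem_coe_finset, Finset.card_eq_sum_card_image l s]
  refine Finset.sum_congr rfl fun μ hμ => b.finrank_eigenspace hT hb fun i => ?_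
  obtain ⟨j, hj, rfl⟩ := Finset.mem_image.mp hμ
  rw [Finset.mem_filter, hs]
  exact ⟨And.right, fun h => ⟨h ▸ (hs j).mp hj, h⟩⟩

end HilbertBasis

variable [CompleteSpace E]

/-- A compact symmetric operator has a Hilbert basis of eigenvectors. -/
theorem exists_hilbertBasis_eigenvectors {T : E →L[ℂ] E} (hc : IsCompactOperator T)
    (hT : T.IsSymmetric) :
    ∃ (ι : Type u) (b : HilbertBasis ι ℂ E) (l : ι → ℝ), ∀ i, T (b i) = (l i : ℂ) • b i := by
  have hcomplete : ∀ μ : ℂ, CompleteSpace (eigenspace (T : Module.End ℂ E) μ) := by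
    intro μ
    have : IsClosed (eigenspace (T : Module.End ℂ E) μ : Set E) := by
      have h : (eigenspace (T : Module.End ℂ E) μ : Set E) = {x | T x = μ • x} := by
        ext x
        simp
      rw [h]
      exact isClosed_eq T.continuous (continuous_const_smul μ)
    exact this.completeSpace_coe
  -- Every complex μ is allowed: trivial eigenspaces contribute an empty basis, so no spectrum has
  -- to be selected.
  choose w e he using fun μ : ℂ => exists_hilbertBasis ℂ (eigenspace (T : Module.End ℂ E) μ)
  have hv : Orthonormal ℂ (fun a : Σ μ, w μ => ((e a.1 a.2 : eigenspace _ a.1) : E)) :=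
    hT.orthogonalFamily_eigenspaces.orthonormal_sigma_orthonormal fun μ => (e μ).orthonormal
  have hbot : (Submodule.span ℂ
      (Set.range fun a : Σ μ, w μ => ((e a.1 a.2 : eigenspace _ a.1) : E)))ᗮ = ⊥ := by
    rw [eq_bot_iff, ← T.orthogonalComplement_iSup_eigenspaces_eq_bot hc hT,
      ← Submodule.iInf_orthogonal]
    -- Every eigenvector is a convergent series of the chosen basis vectors, so orthogonality to
    -- those passes to the whole eigenspace.
    refine fun x hx => (Submodule.mem_iInf _).mpr fun μ => ?_
    refine (Submodule.mem_orthogonal' _ _).mpr fun u hu => ?_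
    have hu' := (((e μ).hasSum_repr ⟨u, hu⟩).mapL
      (eigenspace (T : Module.End ℂ E) μ).subtypeL).mapL (innerSL ℂ x)
    refine hu'.unique ?_
    convert hasSum_zero with i
    have hi := (Submodule.mem_orthogonal' _ _).mp hx _
      (Submodule.subset_span ⟨⟨μ, i⟩, rfl⟩)
    simp [hi]
  refine ⟨Σ μ, w μ, HilbertBasis.mkOfOrthogonalEqBot hv hbot, fun a => a.1.re, fun a => ?_⟩
  rw [HilbertBasis.coe_mkOfOrthogonalEqBot]
  have hmem := (e a.1 a.2).2
  have hne : ((e a.1 a.2 : eigenspace _ a.1) : E) ≠ 0 := hv.ne_zero a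
  have hreal := hT.conj_eigenvalue_eq_self (hasEigenvalue_of_hasEigenvector ⟨hmem, hne⟩)
  rw [Complex.conj_eq_iff_re.mp hreal]
  exact mem_eigenspace_iff.mp hmem

/-- An operator whose values on a Hilbert basis are square summable is compact. -/
theorem HilbertBasis.isCompactOperator_of_summable {ι : Type*} (b : HilbertBasis ι ℂ E)
    {F : E →L[ℂ] E}
    (h : Summable fun i => ‖F (b i)‖ ^ 2) : IsCompactOperator F := by
  classical
  let P : Finset ι → E →L[ℂ] E := fun s => ∑ i ∈ s, (innerSL ℂ (b i)).smulRight (F (b i))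
  have hPapply : ∀ s f, P s f = ∑ i ∈ s, inner ℂ (b i) f • F (b i) := fun s f => by
    simp [P]
  have hP : Tendsto P atTop (nhds F) := by
    rw [Metric.tendsto_nhds]
    intro ε hε
    have hε' : (0 : ℝ) < (ε / 2) ^ 2 := by positivity
    obtain ⟨s, hs⟩ := summable_iff_vanishing_norm.mp h _ hε'
    filter_upwards [eventually_ge_atTop s] with t ht
    rw [dist_eq_norm]
    refine (ContinuousLinearMap.opNorm_le_bound _ (half_pos hε).le fun f => ?_).trans_lt
      (half_lt_self hε)
    have hsum : HasSum (fun i => inner ℂ (b i) f • F (b i)) (F f) := by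
      have := (b.hasSum_repr f).mapL F
      simpa only [map_smul, b.repr_apply_apply] using this
    have hlim : Tendsto (fun r => ‖P t f - ∑ i ∈ r, inner ℂ (b i) f • F (b i)‖) atTop
        (nhds ‖(P t - F) f‖) := (tendsto_const_nhds.sub hsum).norm
    refine le_of_tendsto hlim ?_
    filter_upwards [eventually_ge_atTop t] with r hr
    rw [hPapply, norm_sub_rev, ← Finset.sum_sdiff_eq_sub hr]
    -- Cauchy–Schwarz, with Bessel for the coefficients of f and the small tail of Σ ‖F b_i‖²: the
    -- finite-rank truncations converge in operator norm.
    have hcs : (∑ i ∈ r \ t, ‖inner ℂ (b i) f‖ * ‖F (b i)‖) ^ 2 ≤ ‖f‖ ^ 2 * (ε / 2) ^ 2 := by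
      refine (Finset.sum_mul_sq_le_sq_mul_sq _ _ _).trans ?_
      refine mul_le_mul (b.orthonormal.sum_inner_products_le f) ?_
        (Finset.sum_nonneg fun i _ => by positivity) (by positivity)
      exact (le_abs_self _).trans (hs (r \ t)
        (Finset.disjoint_of_subset_right ht Finset.sdiff_disjoint)).le
    calc ‖∑ i ∈ r \ t, inner ℂ (b i) f • F (b i)‖
        ≤ ∑ i ∈ r \ t, ‖inner ℂ (b i) f‖ * ‖F (b i)‖ := by
          simpa only [norm_smul] using norm_sum_le (r \ t) fun i => inner ℂ (b i) f • F (b i)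
      _ ≤ ε / 2 * ‖f‖ := abs_le_of_sq_le_sq' (by rw [mul_comm, mul_pow]; exact hcs)
          (by positivity) |>.2
  refine isCompactOperator_of_tendsto hP (Eventually.of_forall fun s => ?_)
  refine Finset.sum_induction _ (fun A : E →L[ℂ] E => IsCompactOperator A)
    (fun A B hA hB => hA.add hB) isCompactOperator_zero fun i _ => ?_
  exact (isCompactOperator_of_locallyCompactSpace_dom (innerSL ℂ (b i))).clm_comp
    (ContinuousLinearMap.toSpanSingleton ℂ (F (b i)))

theorem card_eigenvalues_mul_le {ι : Type*} {l : ι → ℝ} {s : Finset ι} {δ τ : ℝ}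
    (hl : ∀ i, 0 ≤ l i) (hs : ∀ i ∈ s, δ ≤ l i) (hτ : HasSum l τ) : δ * s.card ≤ τ :=
  calc δ * s.card = ∑ _i ∈ s, δ := by rw [Finset.sum_const, nsmul_eq_mul, mul_comm]
    _ ≤ ∑ i ∈ s, l i := Finset.sum_le_sum hs
    _ ≤ τ := sum_le_hasSum s (fun i _ => hl i) hτ

/-- Termwise, l(l − δ) is at most 1 − δ when δ ≤ l ≤ 1 and at most 0 when 0 ≤ l < δ. -/
theorem sub_le_mul_card_eigenvalues {ι : Type*} {l : ι → ℝ} {s : Finset ι} {δ τ κ : ℝ}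
    (hl₀ : ∀ i, 0 ≤ l i) (hl₁ : ∀ i, l i ≤ 1) (hs : ∀ i, i ∈ s ↔ δ ≤ l i)
    (hτ : HasSum l τ) (hκ : HasSum (fun i => l i ^ 2) κ) :
    κ - δ * τ ≤ (1 - δ) * s.card := by
  classical
  have h : HasSum (fun i => if i ∈ s then 1 - δ else 0) (∑ i ∈ s, (1 - δ)) := by
    rw [← Finset.sum_congr rfl fun i (hi : i ∈ s) => if_pos hi]
    exact hasSum_sum_of_ne_finset_zero fun i hi => if_neg hi
  rw [Finset.sum_const, nsmul_eq_mul, mul_comm] at h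
  refine hasSum_le (fun i => ?_) (hκ.sub (hτ.mul_left δ)) h
  have h₀ := hl₀ i
  have h₁ := hl₁ i
  split_ifs with hi
  · have := (hs i).mp hi
    nlinarith
  · have := lt_of_not_ge (mt (hs i).mpr hi)
    nlinarith

end EigenvectorBasis

/-! ### Trace and Hilbert–Schmidt identities for a general finite measure. -/

section FiniteFourier

theorem hasSum_of_tsum_ofReal_eq {ι : Type*} {f : ι → ℝ} (hf : ∀ i, 0 ≤ f i) {a : ℝ≥0∞}
    (ha : a ≠ ∞) (h : ∑' i, ENNReal.ofReal (f i) = a) : HasSum f a.toReal := by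
  have hs := ENNReal.hasSum_toReal (h.trans_ne ha)
  simp only [ENNReal.toReal_ofReal (hf _)] at hs
  rw [← h, ENNReal.tsum_toReal_eq fun i => ENNReal.ofReal_ne_top]
  simpa only [ENNReal.toReal_ofReal (hf _)] using hs

theorem HilbertBasis.tsum_enorm_inner_sq {ι E : Type*} [NormedAddCommGroup E]
    [InnerProductSpace ℂ E] (b : HilbertBasis ι ℂ E) (x : E) :
    ∑' i, ‖inner ℂ (b i) x‖ₑ ^ 2 = ‖x‖ₑ ^ 2 := by
  have h := b.hasSum_norm_inner_sq x
  simp only [← ofReal_norm, ← ENNReal.ofReal_pow (norm_nonneg _)]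
  rw [← ENNReal.ofReal_tsum_of_nonneg (fun i => by positivity) h.summable, h.tsum_eq]

section AdjointCompSelf

open ContinuousLinearMap

variable {ι E : Type*} [NormedAddCommGroup E] [InnerProductSpace ℂ E] [CompleteSpace E]
  {F : E →L[ℂ] E} {b : HilbertBasis ι ℂ E} {ν : ι → ℝ}

theorem norm_sq_apply_eq_of_adjoint_comp_self
    (hb : ∀ i, (adjoint F ∘L F) (b i) = (ν i : ℂ) • b i) (i : ι) : ‖F (b i)‖ ^ 2 = ν i := by
  have h : inner ℂ (F (b i)) (F (b i)) = (ν i : ℂ) := by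
    rw [← adjoint_inner_right, ← ContinuousLinearMap.comp_apply, hb, inner_smul_right,
      inner_self_eq_norm_sq_to_K, b.orthonormal.1 i]
    simp
  rw [inner_self_eq_norm_sq_to_K] at h
  exact Complex.ofReal_injective (by rw [← h]; norm_cast)

/-- Parseval for the pair g, F*F g, since ⟨g, F*F g⟩ = ‖F g‖². -/
theorem tsum_mul_enorm_inner_sq_of_adjoint_comp_self
    (hb : ∀ i, (adjoint F ∘L F) (b i) = (ν i : ℂ) • b i) (g : E) :
    ∑' i, ENNReal.ofReal (ν i) * ‖inner ℂ (b i) g‖ₑ ^ 2 = ‖F g‖ₑ ^ 2 := by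
  have hν : ∀ i, 0 ≤ ν i := fun i =>
    (norm_sq_apply_eq_of_adjoint_comp_self hb i) ▸ sq_nonneg ‖F (b i)‖
  have h : HasSum (fun i => ν i * ‖inner ℂ (b i) g‖ ^ 2) (‖F g‖ ^ 2) := by
    have h₁ := Complex.hasSum_re (b.hasSum_inner_mul_inner g ((adjoint F ∘L F) g))
    have h₂ : ∀ i, inner ℂ (b i) ((adjoint F ∘L F) g) = (ν i : ℂ) * inner ℂ (b i) g := fun i => by
      rw [ContinuousLinearMap.comp_apply, adjoint_inner_right, ← adjoint_inner_left,
        ← ContinuousLinearMap.comp_apply, hb, inner_smul_left, Complex.conj_ofReal]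
    have h₃ : inner ℂ g ((adjoint F ∘L F) g) = ((‖F g‖ ^ 2 : ℝ) : ℂ) := by
      rw [ContinuousLinearMap.comp_apply, adjoint_inner_right, inner_self_eq_norm_sq_to_K]
      norm_cast
    rw [h₃, Complex.ofReal_re] at h₁
    convert h₁ using 1
    funext i
    rw [h₂, ← inner_conj_symm g (b i), mul_left_comm, RCLike.conj_mul]
    rw [Complex.re_ofReal_mul]
    norm_cast
  simp only [← ofReal_norm, ← ENNReal.ofReal_pow (norm_nonneg _), ← ENNReal.ofReal_mul (hν _)]
  rw [← ENNReal.ofReal_tsum_of_nonneg (fun i => mul_nonneg (hν i) (by positivity)) h.summable,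
    h.tsum_eq]

end AdjointCompSelf

variable (μ : Measure ℝ) [IsFiniteMeasure μ] (c : ℝ)

theorem coeFn_finiteFourierTransform (f : Lp ℂ 2 μ) :
    finiteFourierTransform μ c f =ᵐ[μ] fourierIntegralFun μ c f :=
  MemLp.coeFn_toLp (memLp_fourierIntegralFun μ c (integrable_of_lpTwo μ f))

theorem enorm_sq_finiteFourierTransform (f : Lp ℂ 2 μ) :
    ‖finiteFourierTransform μ c f‖ₑ ^ 2 = ∫⁻ x, ‖fourierIntegralFun μ c f x‖ₑ ^ 2 ∂μ := by
  rw [enorm_sq_eq_lintegral]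
  exact lintegral_congr_ae ((coeFn_finiteFourierTransform μ c f).fun_comp (fun z => ‖z‖ₑ ^ 2))

theorem memLp_fourierKernel (x : ℝ) :
    MemLp (fun y : ℝ => Complex.exp (Complex.I * c * x * y)) 2 μ :=
  MemLp.of_bound (Continuous.aestronglyMeasurable (by fun_prop)) 1
    (Eventually.of_forall fun y => (norm_fourierKernel c x y).le)

/-- The function `y ↦ e^{-icxy}` as an element of `L²(μ)`. -/
noncomputable def planeWave (x : ℝ) : Lp ℂ 2 μ := (memLp_fourierKernel μ c (-x)).toLp _

theorem coeFn_planeWave (x : ℝ) :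
    planeWave μ c x =ᵐ[μ] fun y : ℝ => Complex.exp (Complex.I * c * (-x : ℝ) * y) :=
  MemLp.coeFn_toLp _

theorem conj_fourierKernel (x y : ℝ) :
    (starRingEnd ℂ) (Complex.exp (Complex.I * c * (-x : ℝ) * y)) =
      Complex.exp (Complex.I * c * x * y) := by
  rw [← Complex.exp_conj]
  simp

/-- Point evaluation of the transform becomes an inner product, so Parseval can be used at each
fixed x. -/
theorem inner_planeWave (x : ℝ) (f : Lp ℂ 2 μ) :
    inner ℂ (planeWave μ c x) f = fourierIntegralFun μ c f x := by
  rw [L2.inner_def]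
  refine integral_congr_ae ?_
  filter_upwards [coeFn_planeWave μ c x] with y hy
  rw [hy, RCLike.inner_apply, conj_fourierKernel, mul_comm]

theorem enorm_planeWave_sq (x : ℝ) : ‖planeWave μ c x‖ₑ ^ 2 = μ Set.univ := by
  rw [enorm_sq_eq_lintegral, ← lintegral_one]
  refine lintegral_congr_ae ?_
  filter_upwards [coeFn_planeWave μ c x] with y hy
  rw [hy, ← ofReal_norm, norm_fourierKernel]
  simp

theorem fourierIntegralFun_planeWave (x z : ℝ) :
    fourierIntegralFun μ c (planeWave μ c x) z = fourierIntegralFun μ c (fun _ => 1) (z - x) := by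
  refine integral_congr_ae ?_
  filter_upwards [coeFn_planeWave μ c x] with y hy
  rw [hy, ← Complex.exp_add, mul_one]
  congr 1
  push_cast
  ring

variable {ι : Type*} [Countable ι] (b : HilbertBasis ι ℂ (Lp ℂ 2 μ))

/-- The squared Hilbert–Schmidt norm of the weighted finite Fourier transform. -/
theorem tsum_enorm_sq_finiteFourierTransform :
    ∑' i, ‖finiteFourierTransform μ c (b i)‖ₑ ^ 2 = μ Set.univ ^ 2 := by
  simp only [enorm_sq_finiteFourierTransform]
  rw [← lintegral_tsum fun i => ?_]
  -- At fixed x the sum Σ |F b_i(x)|² is the squared norm of the plane wave, μ(ℝ), whatever x is.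
  · simp only [← inner_planeWave]
    have h : ∀ x i, ‖inner ℂ (planeWave μ c x) (b i)‖ₑ = ‖inner ℂ (b i) (planeWave μ c x)‖ₑ :=
      fun x i => by rw [← ofReal_norm, ← ofReal_norm, norm_inner_symm]
    simp only [h, b.tsum_enorm_inner_sq, enorm_planeWave_sq, lintegral_const]
    rw [sq]
  · exact ((continuous_fourierIntegralFun μ c
      (integrable_of_lpTwo μ (b i))).measurable.enorm.pow_const 2).aemeasurable

/-- The double integral `∫∫ |∫ e^{ic(z-x)y} dμ(y)|² dμ(z) dμ(x)`. -/
noncomputable def kernelEnergy : ℝ≥0∞ :=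
  ∫⁻ x, ∫⁻ z, ‖fourierIntegralFun μ c (fun _ => 1) (z - x)‖ₑ ^ 2 ∂μ ∂μ

theorem kernelEnergy_ne_top : kernelEnergy μ c ≠ ∞ := by
  have h : kernelEnergy μ c ≤ ∫⁻ _, ∫⁻ _, μ Set.univ ^ 2 ∂μ ∂μ := by
    refine lintegral_mono fun x => lintegral_mono fun z => ?_
    gcongr
    rw [← ofReal_norm]
    refine (ENNReal.ofReal_le_ofReal (norm_fourierIntegralFun_le μ c _ _)).trans ?_
    simp
  refine (h.trans_lt ?_).ne
  simp only [lintegral_const]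
  finiteness

-- For the plane wave e_x, ‖F e_x‖² = Σ ν_i |F b_i(x)|². Integrating in x replaces |F b_i|² by ν_i
-- once more.
open ContinuousLinearMap in
theorem tsum_eigenvalues_sq {ν : ι → ℝ}
    (hb : ∀ i, (adjoint (finiteFourierTransform μ c) ∘L finiteFourierTransform μ c) (b i) =
      (ν i : ℂ) • b i) :
    ∑' i, ENNReal.ofReal (ν i ^ 2) = kernelEnergy μ c := by
  have hν := norm_sq_apply_eq_of_adjoint_comp_self hb
  have h : ∀ x, ∫⁻ z, ‖fourierIntegralFun μ c (fun _ => 1) (z - x)‖ₑ ^ 2 ∂μ =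
      ∑' i, ENNReal.ofReal (ν i) * ‖fourierIntegralFun μ c (b i) x‖ₑ ^ 2 := fun x => by
    simp only [← fourierIntegralFun_planeWave]
    rw [← enorm_sq_finiteFourierTransform, ← tsum_mul_enorm_inner_sq_of_adjoint_comp_self hb]
    refine tsum_congr fun i => ?_
    rw [← inner_planeWave, ← ofReal_norm, ← ofReal_norm, norm_inner_symm]
  have hmeas : ∀ i, AEMeasurable (fun x => ‖fourierIntegralFun μ c (b i) x‖ₑ ^ 2) μ := fun i =>
    ((continuous_fourierIntegralFun μ c
      (integrable_of_lpTwo μ (b i))).measurable.enorm.pow_const 2).aemeasurable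
  rw [kernelEnergy, lintegral_congr h, lintegral_tsum fun i => (hmeas i).const_mul _]
  refine tsum_congr fun i => ?_
  rw [lintegral_const_mul'' _ (hmeas i), ← enorm_sq_finiteFourierTransform, ← hν, ← ofReal_norm,
    ← ENNReal.ofReal_pow (norm_nonneg _), ← ENNReal.ofReal_mul (by positivity), ← sq]

theorem hasSum_norm_sq_finiteFourierTransform :
    HasSum (fun i => ‖finiteFourierTransform μ c (b i)‖ ^ 2) (μ.real Set.univ ^ 2) := by
  rw [Measure.real, ← ENNReal.toReal_pow]
  refine hasSum_of_tsum_ofReal_eq (fun i => by positivity) (by finiteness) ?_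
  rw [← tsum_enorm_sq_finiteFourierTransform μ c b]
  refine tsum_congr fun i => ?_
  rw [ENNReal.ofReal_pow (norm_nonneg _), ofReal_norm]

theorem isCompactOperator_finiteFourierTransform :
    IsCompactOperator (finiteFourierTransform μ c) := by
  obtain ⟨w, b, -⟩ := exists_hilbertBasis ℂ (Lp ℂ 2 μ)
  have : Fact ((2 : ℝ≥0∞) ≠ ∞) := ⟨ENNReal.ofNat_ne_top⟩
  have := b.orthonormal.countable_of_separableSpace
  exact b.isCompactOperator_of_summable (hasSum_norm_sq_finiteFourierTransform μ c b).summable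

-- The measure enters only through its total mass, its kernel energy and the contraction hypothesis
-- `hF`.
open ContinuousLinearMap in
theorem eigenvalueCount_bounds {k δ : ℝ} (hk : 0 < k) (hδ₀ : 0 < δ)
    (hF : ∀ f, k * ‖finiteFourierTransform μ c f‖ ^ 2 ≤ ‖f‖ ^ 2) {T : Lp ℂ 2 μ →L[ℂ] Lp ℂ 2 μ}
    (hT : T = (k : ℂ) • (adjoint (finiteFourierTransform μ c) ∘L finiteFourierTransform μ c)) :
    (eigenvaluesGE T δ).Finite ∧
    (∀ x ∈ eigenvaluesGE T δ, FiniteDimensional ℂ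
      (Module.End.eigenspace (T : Module.End ℂ (Lp ℂ 2 μ)) (x : ℂ))) ∧
    δ * eigenvalueCount T δ ≤ k * μ.real Set.univ ^ 2 ∧
    k ^ 2 * (kernelEnergy μ c).toReal - δ * (k * μ.real Set.univ ^ 2) ≤
      (1 - δ) * eigenvalueCount T δ := by
  set F := finiteFourierTransform μ c with hF_def
  have hFc : IsCompactOperator F := isCompactOperator_finiteFourierTransform μ c
  have hAs : (adjoint F ∘L F).IsSymmetric := (isPositive_adjoint_comp_self F).isSymmetric
  obtain ⟨ι, b, ν, hb⟩ := exists_hilbertBasis_eigenvectors (hFc.clm_comp (adjoint F)) hAs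
  have : Fact ((2 : ℝ≥0∞) ≠ ∞) := ⟨ENNReal.ofNat_ne_top⟩
  have := b.orthonormal.countable_of_separableSpace
  have hν := norm_sq_apply_eq_of_adjoint_comp_self hb
  have hν₀ : ∀ i, 0 ≤ ν i := fun i => hν i ▸ sq_nonneg ‖F (b i)‖
  have hTs : T.IsSymmetric := by
    intro f g
    have := hAs f g
    simp only [coe_coe] at this ⊢
    rw [hT, smul_apply, smul_apply, inner_smul_left, inner_smul_right, Complex.conj_ofReal, this]
  have hTb : ∀ i, T (b i) = ((k * ν i : ℝ) : ℂ) • b i := fun i => by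
    rw [hT, smul_apply, hb, smul_smul, Complex.ofReal_mul]
  have hτ : HasSum (fun i => k * ν i) (k * μ.real Set.univ ^ 2) := by
    simpa only [← hF_def, hν] using (hasSum_norm_sq_finiteFourierTransform μ c b).mul_left k
  have hκ : HasSum (fun i => (k * ν i) ^ 2) (k ^ 2 * (kernelEnergy μ c).toReal) := by
    simpa only [mul_pow] using (hasSum_of_tsum_ofReal_eq (fun i => sq_nonneg (ν i))
      (kernelEnergy_ne_top μ c) (tsum_eigenvalues_sq μ c b hb)).mul_left (k ^ 2)
  have hl₀ : ∀ i, 0 ≤ k * ν i := fun i => mul_nonneg hk.le (hν₀ i)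
  have hl₁ : ∀ i, k * ν i ≤ 1 := fun i => by
    simpa only [hν, b.orthonormal.1 i, one_pow] using hF (b i)
  -- A summable family tends to zero along the cofinite filter.
  have hfin : {i | δ ≤ k * ν i}.Finite := by
    have := hτ.summable.tendsto_cofinite_zero.eventually (gt_mem_nhds hδ₀)
    simpa only [eventually_cofinite, not_lt] using this
  have hs : ∀ i, i ∈ hfin.toFinset ↔ δ ≤ k * ν i := fun i => hfin.mem_toFinset
  refine ⟨?_, fun x hx => b.finiteDimensional_eigenspace hTs hTb hs hx.1, ?_, ?_⟩
  · rw [b.eigenvaluesGE_eq_image hTs hTb hs]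
    exact Finset.finite_toSet _
  · rw [b.eigenvalueCount_eq_card hTs hTb hs]
    exact card_eigenvalues_mul_le hl₀ (fun i hi => (hs i).mp hi) hτ
  · rw [b.eigenvalueCount_eq_card hTs hTb hs]
    exact sub_le_mul_card_eigenvalues hl₀ hl₁ hs hτ hκ

end FiniteFourier

/-! ### The weight: contraction bound and beta integrals. -/

section GegenbauerWeight

open scoped FourierTransform

/-- The weight `(1 - y²)^α` on `[-1, 1]`, extended by zero to the real line. -/
noncomputable def gegenbauerWeight (α y : ℝ) : ℝ := (max (1 - y ^ 2) 0) ^ α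

theorem gegenbauerWeight_nonneg (α y : ℝ) : 0 ≤ gegenbauerWeight α y :=
  Real.rpow_nonneg (le_max_right _ _) _

variable {α : ℝ}

theorem continuous_gegenbauerWeight (hα : 0 < α) : Continuous (gegenbauerWeight α) :=
  Continuous.rpow_const (by fun_prop) fun _ => Or.inr hα.le

theorem gegenbauerWeight_le_one (hα : 0 < α) (y : ℝ) : gegenbauerWeight α y ≤ 1 :=
  Real.rpow_le_one (le_max_right _ _)
    (max_le (by nlinarith [sq_nonneg y]) zero_le_one) hα.le

theorem gegenbauerWeight_of_mem (α : ℝ) {y : ℝ} (hy : y ∈ Set.Icc (-1 : ℝ) 1) :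
    gegenbauerWeight α y = (1 - y ^ 2) ^ α := by
  rw [gegenbauerWeight, max_eq_left (by nlinarith [hy.1, hy.2])]

theorem gegenbauerWeight_of_notMem (hα : 0 < α) {y : ℝ} (hy : y ∉ Set.Icc (-1 : ℝ) 1) :
    gegenbauerWeight α y = 0 := by
  have h : 1 - y ^ 2 ≤ 0 := by
    by_contra! h
    exact hy (abs_le.mp (abs_le_one_iff_mul_self_le_one.mpr (by nlinarith)))
  rw [gegenbauerWeight, max_eq_right h, Real.zero_rpow hα.ne']

theorem gegenbauerWeight_sq (α y : ℝ) :
    gegenbauerWeight α y ^ 2 = gegenbauerWeight (2 * α) y := by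
  rw [gegenbauerWeight, gegenbauerWeight, ← Real.rpow_natCast, ← Real.rpow_mul (le_max_right _ _),
    mul_comm α]
  norm_num

theorem gegenbauerMeasure_eq_withDensity (hα : 0 < α) :
    gegenbauerMeasure α = volume.withDensity fun y => ENNReal.ofReal (gegenbauerWeight α y) := by
  rw [gegenbauerMeasure, ← withDensity_indicator measurableSet_Icc]
  congr 1
  funext y
  by_cases hy : y ∈ Set.Icc (-1 : ℝ) 1
  · rw [Set.indicator_of_mem hy, gegenbauerWeight_of_mem α hy]
  · rw [Set.indicator_of_notMem hy, gegenbauerWeight_of_notMem hα hy, ENNReal.ofReal_zero]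

theorem measurable_ofReal_gegenbauerWeight (hα : 0 < α) :
    Measurable fun y => ENNReal.ofReal (gegenbauerWeight α y) :=
  (continuous_gegenbauerWeight hα).measurable.ennreal_ofReal

theorem lintegral_gegenbauerMeasure (hα : 0 < α) {f : ℝ → ℝ≥0∞} (hf : Measurable f) :
    ∫⁻ y, f y ∂gegenbauerMeasure α = ∫⁻ y, ENNReal.ofReal (gegenbauerWeight α y) * f y := by
  rw [gegenbauerMeasure_eq_withDensity hα, lintegral_withDensity_eq_lintegral_mul _
    (measurable_ofReal_gegenbauerWeight hα) hf]
  rfl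

theorem gegenbauerMeasure_le_volume (hα : 0 < α) : gegenbauerMeasure α ≤ volume := by
  rw [gegenbauerMeasure_eq_withDensity hα]
  refine (withDensity_mono (g := 1) (Eventually.of_forall fun y => ?_)).trans_eq withDensity_one
  exact ENNReal.ofReal_le_one.mpr (gegenbauerWeight_le_one hα y)

theorem integrable_gegenbauerMeasure_iff (hα : 0 < α) {f : ℝ → ℂ} :
    Integrable f (gegenbauerMeasure α) ↔ Integrable fun y => gegenbauerWeight α y • f y := by
  rw [gegenbauerMeasure_eq_withDensity hα, integrable_withDensity_iff_integrable_smul'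
    (measurable_ofReal_gegenbauerWeight hα) (by simp)]
  simp only [ENNReal.toReal_ofReal (gegenbauerWeight_nonneg α _)]

/-- `𝓕` has kernel e^{−2πiyξ}, hence the frequency ξ = −cx/(2π). -/
theorem fourierIntegralFun_gegenbauerMeasure (hα : 0 < α) (c : ℝ) (f : ℝ → ℂ) (x : ℝ) :
    fourierIntegralFun (gegenbauerMeasure α) c f x =
      𝓕 (fun y => gegenbauerWeight α y • f y) (-(c * x) / (2 * Real.pi)) := by
  rw [fourierIntegralFun, gegenbauerMeasure_eq_withDensity hα,
    integral_withDensity_eq_integral_toReal_smul (measurable_ofReal_gegenbauerWeight hα) (by simp),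
    Real.fourier_real_eq_integral_exp_smul]
  refine integral_congr_ae (Eventually.of_forall fun y => ?_)
  simp only [ENNReal.toReal_ofReal (gegenbauerWeight_nonneg α _)]
  rw [smul_comm, smul_eq_mul]
  congr 2
  rw [show -2 * Real.pi * y * (-(c * x) / (2 * Real.pi)) = c * x * y by field_simp]
  push_cast
  ring_nf

theorem lintegral_comp_sub_mul_left (x : ℝ) {a : ℝ} (ha : a ≠ 0) {φ : ℝ → ℝ≥0∞}
    (hφ : Measurable φ) :
    ∫⁻ ξ, φ (x - a * ξ) = ENNReal.ofReal |a⁻¹| * ∫⁻ z, φ z := by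
  rw [← lintegral_sub_left_eq_self φ x, ← smul_eq_mul, ← lintegral_smul_measure,
    ← Real.map_volume_mul_left ha, lintegral_map (by fun_prop) (by fun_prop)]

theorem memLp_two_of_lintegral_ne_top {g : ℝ → ℂ} (hg : AEStronglyMeasurable g volume)
    (h : ∫⁻ x, ‖g x‖ₑ ^ 2 ≠ ∞) : MemLp g 2 := by
  refine ⟨hg, ?_⟩
  rw [eLpNorm_lt_top_iff_lintegral_rpow_enorm_lt_top two_ne_zero ENNReal.ofNat_ne_top]
  simpa using h.lt_top

/-- Since 0 ≤ w ≤ 1, w²|f|² ≤ w|f|². -/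
theorem lintegral_weight_smul_sq_le (hα : 0 < α) {f : ℝ → ℂ} (hf : Measurable f) :
    ∫⁻ y, ‖gegenbauerWeight α y • f y‖ₑ ^ 2 ≤ ∫⁻ y, ‖f y‖ₑ ^ 2 ∂gegenbauerMeasure α := by
  rw [lintegral_gegenbauerMeasure hα (by fun_prop)]
  refine lintegral_mono fun y => ?_
  rw [enorm_smul, mul_pow, Real.enorm_of_nonneg (gegenbauerWeight_nonneg α y)]
  gcongr
  rw [sq]
  exact mul_le_of_le_one_left' (ENNReal.ofReal_le_one.mpr (gegenbauerWeight_le_one hα y))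

/-- The operator `(c / 2π) 𝓕* 𝓕` is a contraction. -/
theorem mul_norm_sq_weightedFourier_le (hα : 0 < α) {c : ℝ} (hc : 0 < c)
    (f : Lp ℂ 2 (gegenbauerMeasure α)) :
    c / (2 * Real.pi) * ‖weightedFourier hα c f‖ ^ 2 ≤ ‖f‖ ^ 2 := by
  have := isFiniteMeasure_gegenbauerMeasure hα
  have hf : Measurable f := (Lp.stronglyMeasurable f).measurable
  set g : ℝ → ℂ := fun y => gegenbauerWeight α y • f y with hg_def
  have hg : Integrable g := (integrable_gegenbauerMeasure_iff hα).mp (integrable_of_lpTwo _ f)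
  have hle : ∫⁻ y, ‖g y‖ₑ ^ 2 ≤ ‖f‖ₑ ^ 2 := by
    rw [enorm_sq_eq_lintegral]
    exact lintegral_weight_smul_sq_le hα hf
  have hg₂ : MemLp g 2 := memLp_two_of_lintegral_ne_top hg.aestronglyMeasurable
    (hle.trans_lt (by finiteness)).ne
  have hcont : Continuous (𝓕 g) :=
    VectorFourier.fourierIntegral_continuous Real.continuous_fourierChar
      (by exact continuous_inner) hg
  have hk : 0 < c / (2 * Real.pi) := by positivity
  -- The factor c/(2π) cancels the Jacobian of the frequency change. Inequality enters only in
  -- enlarging the measure to Lebesgue measure and in w² ≤ w.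
  have hmain : ENNReal.ofReal (c / (2 * Real.pi)) * ‖weightedFourier hα c f‖ₑ ^ 2 ≤ ‖f‖ₑ ^ 2 :=
    calc ENNReal.ofReal (c / (2 * Real.pi)) * ‖weightedFourier hα c f‖ₑ ^ 2
        = ENNReal.ofReal (c / (2 * Real.pi)) *
          ∫⁻ x, ‖𝓕 g (0 - c / (2 * Real.pi) * x)‖ₑ ^ 2 ∂gegenbauerMeasure α := by
          rw [weightedFourier, enorm_sq_finiteFourierTransform]
          congr 1
          refine lintegral_congr fun x => ?_
          rw [fourierIntegralFun_gegenbauerMeasure hα, ← hg_def]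
          congr 3
          ring_nf
      _ ≤ ENNReal.ofReal (c / (2 * Real.pi)) *
          ∫⁻ x, ‖𝓕 g (0 - c / (2 * Real.pi) * x)‖ₑ ^ 2 := by
          gcongr
          exact gegenbauerMeasure_le_volume hα
      _ = ∫⁻ ξ, ‖𝓕 g ξ‖ₑ ^ 2 := by
          rw [lintegral_comp_sub_mul_left (φ := fun ξ => ‖𝓕 g ξ‖ₑ ^ 2) 0 hk.ne'
            (by fun_prop), ← mul_assoc, ← ENNReal.ofReal_mul hk.le, abs_of_pos (by positivity),
            mul_inv_cancel₀ hk.ne', ENNReal.ofReal_one, one_mul]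
      _ = ∫⁻ y, ‖g y‖ₑ ^ 2 := lintegral_enorm_sq_fourier hg hg₂
      _ ≤ ‖f‖ₑ ^ 2 := hle
  rw [← ofReal_norm, ← ofReal_norm, ← ENNReal.ofReal_pow (norm_nonneg _),
    ← ENNReal.ofReal_pow (norm_nonneg _), ← ENNReal.ofReal_mul hk.le,
    ENNReal.ofReal_le_ofReal_iff (by positivity)] at hmain
  exact hmain

/-- Under y = 2x − 1 one has 1 − y² = 4x(1 − x); this gives 2^{2a}, and the Jacobian gives another
2. -/
theorem integral_one_sub_sq_rpow {a : ℝ} (ha : 0 < a) :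
    ∫ y in (-1 : ℝ)..1, (1 - y ^ 2) ^ a =
      2 ^ (2 * a + 1) * ProbabilityTheory.beta (a + 1) (a + 1) := by
  have hbeta : ProbabilityTheory.beta (a + 1) (a + 1) =
      ∫ x in (0 : ℝ)..1, (x * (1 - x)) ^ a := by
    rw [ProbabilityTheory.beta_eq_betaIntegralReal _ _ (by positivity) (by positivity),
      ← Complex.ofReal_re (∫ x in (0 : ℝ)..1, (x * (1 - x)) ^ a), ← intervalIntegral.integral_ofReal,
      Complex.betaIntegral]
    congr 1
    refine intervalIntegral.integral_congr fun x hx => ?_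
    rw [Set.uIcc_of_le zero_le_one] at hx
    have hx' : 0 ≤ 1 - x := sub_nonneg.mpr hx.2
    simp only [Complex.ofReal_add, Complex.ofReal_one, add_sub_cancel_right]
    rw [Real.mul_rpow hx.1 hx', Complex.ofReal_mul, Complex.ofReal_cpow hx.1,
      Complex.ofReal_cpow hx', Complex.ofReal_sub, Complex.ofReal_one]
  have hsub := intervalIntegral.integral_comp_mul_sub (a := 0) (b := 1)
    (fun y : ℝ => (1 - y ^ 2) ^ a) (two_ne_zero' ℝ) 1
  norm_num at hsub
  have h4 : ∫ x in (0 : ℝ)..1, (1 - (2 * x - 1) ^ 2) ^ a =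
      2 ^ (2 * a) * ∫ x in (0 : ℝ)..1, (x * (1 - x)) ^ a := by
    rw [← intervalIntegral.integral_const_mul]
    refine intervalIntegral.integral_congr fun x hx => ?_
    rw [Set.uIcc_of_le zero_le_one] at hx
    have hx' : 0 ≤ x * (1 - x) := mul_nonneg hx.1 (sub_nonneg.mpr hx.2)
    rw [Real.rpow_mul zero_le_two, ← Real.mul_rpow (by positivity) hx']
    congr 1
    norm_num
    ring
  rw [hbeta, Real.rpow_add_one two_ne_zero]
  linarith

theorem lintegral_gegenbauerWeight {a : ℝ} (ha : 0 < a) :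
    ∫⁻ y, ENNReal.ofReal (gegenbauerWeight a y) =
      ENNReal.ofReal (2 ^ (2 * a + 1) * ProbabilityTheory.beta (a + 1) (a + 1)) := by
  have hcs : HasCompactSupport (gegenbauerWeight a) :=
    HasCompactSupport.intro isCompact_Icc fun y hy => gegenbauerWeight_of_notMem ha hy
  rw [← ofReal_integral_eq_lintegral_ofReal
    ((continuous_gegenbauerWeight ha).integrable_of_hasCompactSupport hcs)
    (Eventually.of_forall fun y => gegenbauerWeight_nonneg a y), ← integral_one_sub_sq_rpow ha,
    intervalIntegral.integral_of_le (by norm_num), ← integral_Icc_eq_integral_Ioc,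
    ← setIntegral_eq_integral_of_forall_compl_eq_zero (s := Set.Icc (-1 : ℝ) 1)
      fun y hy => gegenbauerWeight_of_notMem ha hy]
  congr 1
  exact setIntegral_congr_fun measurableSet_Icc fun y hy => gegenbauerWeight_of_mem a hy

theorem measureReal_univ_gegenbauerMeasure (hα : 0 < α) :
    (gegenbauerMeasure α).real Set.univ =
      2 ^ (2 * α + 1) * ProbabilityTheory.beta (α + 1) (α + 1) := by
  have h := ProbabilityTheory.beta_pos (show 0 < α + 1 by positivity) (show 0 < α + 1 by positivity)
  rw [Measure.real, ← lintegral_one, lintegral_gegenbauerMeasure hα measurable_const]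
  simp only [mul_one]
  rw [lintegral_gegenbauerWeight hα, ENNReal.toReal_ofReal (by positivity)]

end GegenbauerWeight

/-! ### Asymptotics of the second moment. -/

section KernelEnergy

open scoped FourierTransform

variable {α : ℝ}

theorem integrable_ofReal_gegenbauerWeight (hα : 0 < α) :
    Integrable fun y => (gegenbauerWeight α y : ℂ) := by
  have hcs : HasCompactSupport (gegenbauerWeight α) :=
    HasCompactSupport.intro isCompact_Icc fun y hy => gegenbauerWeight_of_notMem hα hy
  exact ((continuous_gegenbauerWeight hα).integrable_of_hasCompactSupport hcs).ofReal

/-- The Fourier transform of the weight `(1 - y²)^α`. -/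
noncomputable def gegenbauerFourier (α : ℝ) : ℝ → ℂ := 𝓕 fun y => (gegenbauerWeight α y : ℂ)

theorem continuous_gegenbauerFourier (hα : 0 < α) : Continuous (gegenbauerFourier α) :=
  VectorFourier.fourierIntegral_continuous Real.continuous_fourierChar
    (by exact continuous_inner) (integrable_ofReal_gegenbauerWeight hα)

theorem lintegral_gegenbauerWeight_sq (hα : 0 < α) :
    ∫⁻ y, ENNReal.ofReal (gegenbauerWeight α y) * ENNReal.ofReal (gegenbauerWeight α y) =
      ENNReal.ofReal
        (2 ^ (4 * α + 1) * ProbabilityTheory.beta (2 * α + 1) (2 * α + 1)) := by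
  simp only [← ENNReal.ofReal_mul (gegenbauerWeight_nonneg α _), ← sq, gegenbauerWeight_sq]
  rw [lintegral_gegenbauerWeight (by positivity), ← mul_assoc 2 2 α]
  norm_num

/-- By Plancherel this is the same constant as ∫ w², so the limiting energy is a perfect square. -/
theorem lintegral_gegenbauerFourier_sq (hα : 0 < α) :
    ∫⁻ ξ, ‖gegenbauerFourier α ξ‖ₑ ^ 2 =
      ENNReal.ofReal
        (2 ^ (4 * α + 1) * ProbabilityTheory.beta (2 * α + 1) (2 * α + 1)) := by
  have h : ∫⁻ y, ‖(gegenbauerWeight α y : ℂ)‖ₑ ^ 2 = ENNReal.ofReal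
      (2 ^ (4 * α + 1) * ProbabilityTheory.beta (2 * α + 1) (2 * α + 1)) := by
    rw [← lintegral_gegenbauerWeight_sq hα]
    refine lintegral_congr fun y => ?_
    rw [← ofReal_norm, Complex.norm_of_nonneg (gegenbauerWeight_nonneg α y), sq]
  have hw := integrable_ofReal_gegenbauerWeight hα
  simp only [gegenbauerFourier]
  rw [lintegral_enorm_sq_fourier hw
    (memLp_two_of_lintegral_ne_top hw.aestronglyMeasurable (h.trans_ne ENNReal.ofReal_ne_top)), h]

/-- The integral `∫ w(x) ∫ w(x - aξ) |ŵ(ξ)|² dξ dx`, for the weight `w = (1 - y²)^α`. -/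
noncomputable def rescaledEnergy (α a : ℝ) : ℝ≥0∞ :=
  ∫⁻ x, ENNReal.ofReal (gegenbauerWeight α x) *
    ∫⁻ ξ, ENNReal.ofReal (gegenbauerWeight α (x - a * ξ)) *
      ‖gegenbauerFourier α ξ‖ₑ ^ 2

/-- The substitution z = x − (2π/c)ξ moves the dependence on c from ŵ to the continuous bounded
weight. -/
theorem kernelEnergy_gegenbauerMeasure (hα : 0 < α) {c : ℝ} (hc : 0 < c) :
    kernelEnergy (gegenbauerMeasure α) c =
      ENNReal.ofReal (2 * Real.pi / c) * rescaledEnergy α (2 * Real.pi / c) := by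
  have := isFiniteMeasure_gegenbauerMeasure hα
  have hw := continuous_gegenbauerWeight hα
  have hwm := hw.measurable
  have hWm := (continuous_gegenbauerFourier hα).measurable
  have hΩ : ∀ t, fourierIntegralFun (gegenbauerMeasure α) c (fun _ => 1) t =
      gegenbauerFourier α (-(c * t) / (2 * Real.pi)) := fun t => by
    rw [fourierIntegralFun_gegenbauerMeasure hα]
    simp only [Complex.real_smul, mul_one, gegenbauerFourier]
  have ha : 0 < 2 * Real.pi / c := by positivity
  have hinner : ∀ x, ∫⁻ z, ‖fourierIntegralFun (gegenbauerMeasure α) c (fun _ => 1) (z - x)‖ₑ ^ 2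
      ∂gegenbauerMeasure α = ENNReal.ofReal (2 * Real.pi / c) *
        ∫⁻ ξ, ENNReal.ofReal (gegenbauerWeight α (x - 2 * Real.pi / c * ξ)) *
          ‖gegenbauerFourier α ξ‖ₑ ^ 2 := fun x => by
    simp only [hΩ]
    rw [lintegral_gegenbauerMeasure hα (by fun_prop)]
    have h := lintegral_comp_sub_mul_left x ha.ne'
      (φ := fun z => ENNReal.ofReal (gegenbauerWeight α z) *
        ‖gegenbauerFourier α (-(c * (z - x)) / (2 * Real.pi))‖ₑ ^ 2)
      (by fun_prop)
    have hξ : ∀ ξ, -(c * (x - 2 * Real.pi / c * ξ - x)) / (2 * Real.pi) = ξ := fun ξ => by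
      field_simp
      ring
    simp only [hξ] at h
    rw [h, ← mul_assoc, ← ENNReal.ofReal_mul ha.le, abs_of_pos (by positivity),
      mul_inv_cancel₀ ha.ne', ENNReal.ofReal_one, one_mul]
  rw [kernelEnergy, lintegral_congr hinner]
  have hmeas : Measurable fun x =>
      ∫⁻ ξ, ENNReal.ofReal (gegenbauerWeight α (x - 2 * Real.pi / c * ξ)) *
        ‖gegenbauerFourier α ξ‖ₑ ^ 2 :=
    Measurable.lintegral_prod_right' (f := fun p : ℝ × ℝ =>
      ENNReal.ofReal (gegenbauerWeight α (p.1 - 2 * Real.pi / c * p.2)) *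
        ‖gegenbauerFourier α p.2‖ₑ ^ 2) (by fun_prop)
  rw [lintegral_const_mul _ hmeas, lintegral_gegenbauerMeasure hα hmeas, rescaledEnergy]

/-- Dominated convergence twice: |ŵ|² dominates the inner integrand, and w times the total mass of
|ŵ|² the outer one. -/
theorem tendsto_rescaledEnergy (hα : 0 < α) :
    Tendsto (rescaledEnergy α) (nhds 0) (nhds (ENNReal.ofReal
      (2 ^ (4 * α + 1) * ProbabilityTheory.beta (2 * α + 1) (2 * α + 1)) ^ 2)) := by
  set S := ENNReal.ofReal
    (2 ^ (4 * α + 1) * ProbabilityTheory.beta (2 * α + 1) (2 * α + 1)) with hS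
  have hw := continuous_gegenbauerWeight hα
  have hwm := hw.measurable
  have hWm := (continuous_gegenbauerFourier hα).measurable
  have hint := lintegral_gegenbauerFourier_sq hα
  have hle : ∀ y, ENNReal.ofReal (gegenbauerWeight α y) ≤ 1 := fun y =>
    ENNReal.ofReal_le_one.mpr (gegenbauerWeight_le_one hα y)
  have hbound : ∀ a x ξ, ENNReal.ofReal (gegenbauerWeight α (x - a * ξ)) *
      ‖gegenbauerFourier α ξ‖ₑ ^ 2 ≤
        ‖gegenbauerFourier α ξ‖ₑ ^ 2 := fun a x ξ =>
    mul_le_of_le_one_left' (hle _)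
  have hinner : ∀ x, Tendsto (fun a => ∫⁻ ξ, ENNReal.ofReal (gegenbauerWeight α (x - a * ξ)) *
      ‖gegenbauerFourier α ξ‖ₑ ^ 2) (nhds 0)
        (nhds (ENNReal.ofReal (gegenbauerWeight α x) * S)) := fun x => by
    rw [hS, ← hint, ← lintegral_const_mul _ (by fun_prop)]
    refine tendsto_lintegral_filter_of_dominated_convergence _
      (Eventually.of_forall fun a => by fun_prop)
      (Eventually.of_forall fun a => Eventually.of_forall (hbound a x))
      (hint.trans_ne ENNReal.ofReal_ne_top) (Eventually.of_forall fun ξ => ?_)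
    refine ENNReal.Tendsto.mul_const (ENNReal.tendsto_ofReal ?_) (Or.inr (by finiteness))
    have : Continuous fun a => gegenbauerWeight α (x - a * ξ) := by fun_prop
    simpa using this.tendsto 0
  have hlim : ∫⁻ x, ENNReal.ofReal (gegenbauerWeight α x) *
      (ENNReal.ofReal (gegenbauerWeight α x) * S) = S ^ 2 := by
    simp only [← mul_assoc]
    rw [lintegral_mul_const _ (by fun_prop), lintegral_gegenbauerWeight_sq hα, ← hS, sq]
  rw [← hlim]
  refine tendsto_lintegral_filter_of_dominated_convergence
    (fun x => ENNReal.ofReal (gegenbauerWeight α x) * S)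
    (Eventually.of_forall fun a => ?_) (Eventually.of_forall fun a => Eventually.of_forall
      fun x => ?_) ?_ (Eventually.of_forall fun x => ?_)
  · refine (measurable_ofReal_gegenbauerWeight hα).mul ?_
    exact Measurable.lintegral_prod_right' (f := fun p : ℝ × ℝ =>
      ENNReal.ofReal (gegenbauerWeight α (p.1 - a * p.2)) *
        ‖gegenbauerFourier α p.2‖ₑ ^ 2) (by fun_prop)
  · gcongr
    rw [hS, ← hint]
    exact lintegral_mono (hbound a x)
  · rw [lintegral_mul_const _ (by fun_prop), lintegral_gegenbauerWeight hα, hS]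
    finiteness
  · exact ENNReal.Tendsto.const_mul (hinner x) (Or.inr ENNReal.ofReal_ne_top)

/-- The factors B(α+1, α+1)² cancel, and 2^{4α} · 2^{4α+2} = (2^{4α+1})². -/
theorem gammaConst_mul_mainTerm (hα : 0 < α) (c : ℝ) :
    gammaConst α * mainTerm α c = c / (2 * Real.pi) *
      (2 ^ (4 * α + 1) * ProbabilityTheory.beta (2 * α + 1) (2 * α + 1)) ^ 2 := by
  have h := ProbabilityTheory.beta_pos (show 0 < α + 1 by positivity) (show 0 < α + 1 by positivity)
  have h₂ : (2 : ℝ) ^ (2 * α + 1) = 2 ^ (2 * α) * 2 := Real.rpow_add_one two_ne_zero _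
  have h₄ : (2 : ℝ) ^ (4 * α) = 2 ^ (2 * α) * 2 ^ (2 * α) := by
    rw [← Real.rpow_add two_pos]
    ring_nf
  rw [gammaConst, mainTerm, h₂, Real.rpow_add_one two_ne_zero (4 * α), h₄]
  field_simp

/-- As (c/2π)² · (2π/c) = c/2π, the difference is O(c) times the o(1) error of the rescaled energy.
-/
theorem tendsto_sq_mul_kernelEnergy_sub (hα : 0 < α) :
    (fun c : ℝ => (c / (2 * Real.pi)) ^ 2 * (kernelEnergy (gegenbauerMeasure α) c).toReal -
      gammaConst α * mainTerm α c) =o[atTop] fun c : ℝ => c := by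
  set S := 2 ^ (4 * α + 1) * ProbabilityTheory.beta (2 * α + 1) (2 * α + 1) with hS
  have hS₀ : 0 ≤ S := by
    have := ProbabilityTheory.beta_pos (show 0 < 2 * α + 1 by positivity)
      (show 0 < 2 * α + 1 by positivity)
    positivity
  have hlim : Tendsto (fun c : ℝ => (rescaledEnergy α (2 * Real.pi / c)).toReal) atTop
      (nhds (S ^ 2)) := by
    have h := (ENNReal.tendsto_toReal (by finiteness)).comp ((tendsto_rescaledEnergy hα).comp
      (tendsto_const_nhds (x := 2 * Real.pi) |>.div_atTop tendsto_id))
    rw [ENNReal.toReal_pow, ENNReal.toReal_ofReal hS₀] at h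
    exact h
  have hdiff : (fun c : ℝ => (rescaledEnergy α (2 * Real.pi / c)).toReal - S ^ 2) =o[atTop]
      fun _ => (1 : ℝ) := (isLittleO_one_iff ℝ).mpr (tendsto_sub_nhds_zero_iff.mpr hlim)
  have hbig : (fun c : ℝ => c / (2 * Real.pi)) =O[atTop] fun c : ℝ => c := by
    simpa only [div_eq_inv_mul] using (isBigO_refl (fun c : ℝ => c) atTop).const_mul_left _
  refine (hbig.mul_isLittleO hdiff).congr' ?_ (by simp)
  filter_upwards [eventually_gt_atTop 0] with c hc
  rw [gammaConst_mul_mainTerm hα, kernelEnergy_gegenbauerMeasure hα hc, ENNReal.toReal_mul,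
    ENNReal.toReal_ofReal (by positivity), ← hS]
  field_simp

end KernelEnergy

/-! ### The eigenvalue count. -/

theorem theorem3 (α δ : ℝ) (hα : 0 < α) (hδ₀ : 0 < δ) (hδ₁ : δ < 1) :
    (∀ c : ℝ, 0 < c →
      (eigenvaluesGE (weightedSinc hα c) δ).Finite ∧
      (∀ μ ∈ eigenvaluesGE (weightedSinc hα c) δ, FiniteDimensional ℂ
        (Module.End.eigenspace (weightedSinc hα c : Module.End ℂ (Lp ℂ 2 (gegenbauerMeasure α)))
          (μ : ℂ))) ∧
      (eigenvalueCount (weightedSinc hα c) δ : ℝ) ≤ 1 / δ * mainTerm α c) ∧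
    ∃ r : ℝ → ℝ, r =o[atTop] (fun c : ℝ => c) ∧
      ∀ c : ℝ, 0 < c →
        (gammaConst α - δ) / (1 - δ) * mainTerm α c + r c ≤
          (eigenvalueCount (weightedSinc hα c) δ : ℝ) := by
  have := isFiniteMeasure_gegenbauerMeasure hα
  have hδ : 0 < 1 - δ := sub_pos.mpr hδ₁
  have hmain : ∀ c, c / (2 * Real.pi) * (gegenbauerMeasure α).real Set.univ ^ 2 = mainTerm α c :=
    fun c => by rw [measureReal_univ_gegenbauerMeasure hα, mainTerm]
  have hbounds := fun (c : ℝ) (hc : 0 < c) =>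
    eigenvalueCount_bounds (gegenbauerMeasure α) c (k := c / (2 * Real.pi)) (by positivity) hδ₀
      (mul_norm_sq_weightedFourier_le hα hc) (T := weightedSinc hα c) rfl
  simp only [hmain] at hbounds
  -- The remainder is (κ − γ_α τ)/(1 − δ), which makes the lower bound exactly κ − δτ ≤ (1 − δ)
  -- M_c(δ) divided by 1 − δ.
  refine ⟨fun c hc => ?_, fun c => (1 - δ)⁻¹ * ((c / (2 * Real.pi)) ^ 2 *
    (kernelEnergy (gegenbauerMeasure α) c).toReal - gammaConst α * mainTerm α c),
    (tendsto_sq_mul_kernelEnergy_sub hα).const_mul_left _, fun c hc => ?_⟩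
  · obtain ⟨h₁, h₂, h₃, -⟩ := hbounds c hc
    refine ⟨h₁, h₂, ?_⟩
    rw [one_div, inv_mul_eq_div, le_div_iff₀ hδ₀]
    linarith
  · obtain ⟨-, -, -, h⟩ := hbounds c hc
    refine le_of_mul_le_mul_left (le_trans (le_of_eq ?_) h) hδ
    field_simp
    ring
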